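/- Let $d=2r$ with $r\ge 1$ an integer, let $\sigma_0=\frac1r\sum_{j=0}^{r-1}|j\rangle\langle j|$ and $\sigma_1=\frac1r\sum_{j=r}^{2r-1}|j\rangle\langle j|$ be states on $\mathbb C^d$, and let $\mathsf Q_d$ be the rank-$d/2$ Haar-measure encryption of one bit: the key is a unitary $U\in\mathcal U(d)$ drawn from the Haar probability measure, and the bit $m$ is encrypted as $U\sigma_mU^*$. A telegraphing-distinguishing attack consists of a finite-dimensional Hilbert space $B$, a measurement channel $\Phi:\mathcal B(\mathbb C^d)\to\mathcal B(B)$, i.e. $\Phi(\rho)=\sum_{x\in X}\mathrm{Tr}[P_x\rho]\,|e_x\rangle\langle e_x|$ for a finite POVM $\{P_x\}_{x\in X}$ on $\mathbb C^d$ and orthonormal vectors $e_x\in B$, and for each key $U$ a POVM $\{P^U_0,P^U_1\}$ on $B$ (such that the integrand below is measurable in $U$). Its success probability is $$\int_{\mathcal U(d)}\frac12\sum_{m\in\{0,1\}}\mathrm{Tr}\big[P^U_m\,\Phi(U\sigma_mU^*)\big]\,dU ,$$ and the telegraphing-distinguishing value $\mathfrak c^2_{1\to1}(\mathsf Q_d|\mathscr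 M)$ is the supremum of this quantity over all such attacks. Then $$\mathfrak c^2_{1\to1}(\mathsf Q_d|\mathscr M)\le\frac12+\frac1{2\sqrt{d+1}} .$$ Consequently the scheme is strongly untelegraphable-indistinguishable secure: if $(d_\lambda)_{\lambda\in\mathbb N}$ is a sequence of positive even integers such that $1/d_\lambda$ is negligible (decays faster than every inverse polynomial in $\lambda$; e.g. $d_\lambda=2^{\lambda+1}$), then there is a negligible function $\eta$ with $\mathfrak c^2_{1\to1}(\mathsf Q_{d_\lambda}|\mathscr M)\le\frac12+\eta(\lambda)$ for every $\lambda$. -/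

import Mathlib

open scoped ComplexOrder

/-! Finite-dimensional Hilbert spaces are `ℂ^A` for a finite register `A`; operators on `ℂ^A` are
matrices indexed by `A`. -/

namespace Telegraph

/-- A density operator: positive semidefinite with unit trace. -/
structure IsState {A : Type} [Fintype A] (ρ : Matrix A A ℂ) : Prop where
  posSemidef : ρ.PosSemidef
  trace_eq_one : ρ.trace = 1

/-- A POVM: a finite family of positive semidefinite operators summing to the identity. -/
structure IsPOVM {ι A : Type} [Fintype ι] [Fintype A] [DecidableEq A]
    (P : ι → Matrix A A ℂ) : Prop where
  posSemidef : ∀ i, (P i).PosSemidef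
  sum_eq_one : ∑ i, P i = 1

/-- Complete positivity: `Φ ⊗ id_k` maps positive semidefinite operators on `ℂ^A ⊗ ℂ^k` to
positive semidefinite operators on `ℂ^B ⊗ ℂ^k`, for every `k`. -/
def IsCompletelyPositive {A B : Type} [Fintype A] [Fintype B]
    (Φ : Matrix A A ℂ →ₗ[ℂ] Matrix B B ℂ) : Prop :=
  ∀ (k : ℕ) (R : Matrix (A × Fin k) (A × Fin k) ℂ), R.PosSemidef →
    (Matrix.of fun p q : B × Fin k =>
      Φ (Matrix.of fun a a' : A => R (a, p.2) (a', q.2)) p.1 q.1).PosSemidef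

/-- A quantum channel: completely positive and trace preserving. -/
structure IsQuantumChannel {A B : Type} [Fintype A] [Fintype B]
    (Φ : Matrix A A ℂ →ₗ[ℂ] Matrix B B ℂ) : Prop where
  completelyPositive : IsCompletelyPositive Φ
  trace_preserving : ∀ ρ, (Φ ρ).trace = ρ.trace

/-- A collection of maps between operator spaces, for all finite input and output registers. -/
abbrev ChannelClass : Type 1 :=
  ∀ ⦃A B : Type⦄ [Fintype A] [DecidableEq A] [Fintype B] [DecidableEq B],
    (Matrix A A ℂ →ₗ[ℂ] Matrix B B ℂ) → Prop

/-- The measurement (quantum-to-classical) channels: `Φ(ρ) = ∑ₓ Tr[Pₓ ρ] |eₓ⟩⟨eₓ|` for a POVM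
`(Pₓ)` and orthonormal vectors `(eₓ)` of the output space. -/
def measurementChannels : ChannelClass := fun A B _ _ _ _ Φ =>
  ∃ (X : Type) (_ : Fintype X) (P : X → Matrix A A ℂ) (e : X → EuclideanSpace ℂ B),
    IsPOVM P ∧ Orthonormal ℂ e ∧
      ∀ ρ, Φ ρ = ∑ x, (P x * ρ).trace • Matrix.vecMulVec (e x).ofLp (star (e x).ofLp)

/-- A quantum encryption of classical messages. -/
structure QECM where
  /-- the set of messages -/
  Msg : Type
  [fintypeMsg : Fintype Msg]
  /-- the set of keys -/
  Key : Type
  [measurableKey : MeasurableSpace Key]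
  /-- the key distribution -/
  keyDist : MeasureTheory.Measure Key
  [isProbability : MeasureTheory.IsProbabilityMeasure keyDist]
  /-- the register of the codespace -/
  Code : Type
  [fintypeCode : Fintype Code]
  [decEqCode : DecidableEq Code]
  /-- the ciphertexts -/
  cipher : Key → Msg → Matrix Code Code ℂ
  isState_cipher : ∀ k m, IsState (cipher k m)

attribute [instance] QECM.fintypeMsg QECM.measurableKey QECM.isProbability QECM.fintypeCode
  QECM.decEqCode

/-- A `1`-to-`1` `N`-message cloning attack over `F` against `Q`. The last field says that the
integral defining the success probability makes sense. -/
structure Attack (Q : QECM) (N : ℕ) (F : ChannelClass) where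
  /-- the set of `N` challenge messages -/
  msgs : Finset Q.Msg
  card_msgs : msgs.card = N
  /-- the register of the receiver -/
  Out : Type
  [fintypeOut : Fintype Out]
  [decEqOut : DecidableEq Out]
  /-- the receiver's measurement, depending on the key -/
  povm : Q.Key → msgs → Matrix Out Out ℂ
  isPOVM_povm : ∀ k, IsPOVM (povm k)
  /-- the channel applied to the ciphertext, without the key -/
  channel : Matrix Q.Code Q.Code ℂ →ₗ[ℂ] Matrix Out Out ℂ
  isQuantumChannel : IsQuantumChannel channel
  channel_mem : F channel
  aemeasurable_win : AEMeasurable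
    (fun k => (1 / (N : ℝ)) * ∑ m : msgs, (povm k m * channel (Q.cipher k m)).trace.re) Q.keyDist

attribute [instance] Attack.fintypeOut Attack.decEqOut

/-- The success (cloning) probability of an attack. The traces are real. -/
noncomputable def Attack.prob {Q : QECM} {N : ℕ} {F : ChannelClass} (𝒜 : Attack Q N F) : ℝ :=
  ∫ k, (1 / (N : ℝ)) *
    ∑ m : 𝒜.msgs, (𝒜.povm k m * 𝒜.channel (Q.cipher k m)).trace.re ∂Q.keyDist

/-- The `1`-to-`1` `N`-message cloning value over `F`: the supremum of the success probabilities
of all attacks, taken in the extended reals. -/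
noncomputable def QECM.cloningValue (Q : QECM) (N : ℕ) (F : ChannelClass) : EReal :=
  ⨆ 𝒜 : Attack Q N F, (𝒜.prob : EReal)

/-- The (one-copy) telegraphing-distinguishing value. -/
noncomputable def QECM.telegraphingDistinguishingValue (Q : QECM) : EReal :=
  Q.cloningValue 2 measurementChannels

/-- `ε`-untelegraphable-indistinguishable security. -/
def QECM.IsUntelegraphableIndistinguishable (Q : QECM) (ε : ℝ) : Prop :=
  Q.telegraphingDistinguishingValue ≤ ((1 / 2 + ε : ℝ) : EReal)

/-- A negligible function of the security parameter. -/
def Negligible (η : ℕ → ℝ) : Prop :=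
  Asymptotics.SuperpolynomialDecay Filter.atTop (fun l : ℕ => (l : ℝ)) η

/-- Strong untelegraphable-indistinguishable security of a family of schemes. -/
def IsStronglyUntelegraphableIndistinguishable (Q : ℕ → QECM) : Prop :=
  ∃ η : ℕ → ℝ, Negligible η ∧ ∀ l, (Q l).IsUntelegraphableIndistinguishable (η l)

noncomputable instance unitaryMeasurableSpace (d : ℕ) : MeasurableSpace (Matrix.unitaryGroup (Fin d) ℂ) :=
  borel _

instance unitaryBorelSpace (d : ℕ) : BorelSpace (Matrix.unitaryGroup (Fin d) ℂ) := ⟨rfl⟩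

instance unitaryCompactSpace (d : ℕ) : CompactSpace (Matrix.unitaryGroup (Fin d) ℂ) := by
  have hclosed : IsClosed {U : Matrix (Fin d) (Fin d) ℂ | U * star U = 1} :=
    isClosed_eq (by fun_prop) continuous_const
  have hcpt : IsCompact (Set.univ.pi fun _ : Fin d => Set.univ.pi fun _ : Fin d =>
      Metric.closedBall (0 : ℂ) 1) :=
    isCompact_univ_pi fun _ => isCompact_univ_pi fun _ => isCompact_closedBall 0 1
  have hset : ((Matrix.unitaryGroup (Fin d) ℂ : Submonoid (Matrix (Fin d) (Fin d) ℂ)) :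
      Set (Matrix (Fin d) (Fin d) ℂ)) = {U | U * star U = 1} := by
    ext U
    exact Matrix.mem_unitaryGroup_iff
  refine isCompact_iff_compactSpace.mp (hcpt.of_isClosed_subset (hset ▸ hclosed) ?_)
  intro U hU i _ j _
  simpa using entry_norm_bound_of_unitary hU i j

/-- The Haar probability measure on the unitary group. -/
noncomputable def haarUnitary (d : ℕ) :
    MeasureTheory.Measure (Matrix.unitaryGroup (Fin d) ℂ) :=
  MeasureTheory.Measure.haarMeasure ⊤

instance haarUnitary_isProbability (d : ℕ) :
    MeasureTheory.IsProbabilityMeasure (haarUnitary d) :=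
  ⟨MeasureTheory.Measure.haarMeasure_self⟩

/-- The state `σᵢ = (1/r) ∑_{j = ri}^{r(i+1)-1} |j⟩⟨j|` on `ℂ^{rn}`. -/
noncomputable def blockState (r n : ℕ) (i : Fin n) : Matrix (Fin (r * n)) (Fin (r * n)) ℂ :=
  Matrix.diagonal fun j => if r * i ≤ j ∧ (j : ℕ) < r * (i + 1) then 1 / (r : ℂ) else 0

theorem isState_blockState (r n : ℕ) (hr : 0 < r) (i : Fin n) : IsState (blockState r n i) := by
  constructor
  · refine Matrix.PosSemidef.diagonal fun j => ?_
    show (0 : ℂ) ≤ if _ then _ else _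
    split_ifs
    · simp
    · exact le_rfl
  · have hle : r * (i + 1) ≤ r * n := Nat.mul_le_mul_left r i.2
    have hr' : (r : ℂ) ≠ 0 := by exact_mod_cast hr.ne'
    rw [blockState, Matrix.trace_diagonal,
      Fin.sum_univ_eq_sum_range
        (fun j => if r * i ≤ j ∧ j < r * (i + 1) then 1 / (r : ℂ) else 0) (r * n),
      ← Finset.sum_filter]
    have : (Finset.range (r * n)).filter (fun j => r * i ≤ j ∧ j < r * (i + 1)) =
        Finset.Ico (r * i) (r * (i + 1)) := by
      ext j
      simp only [Finset.mem_filter, Finset.mem_range, Finset.mem_Ico]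
      omega
    rw [this, Finset.sum_const, Nat.card_Ico, mul_add, mul_one, Nat.add_sub_cancel_left,
      nsmul_eq_mul, mul_one_div_cancel hr']

theorem IsState.conj {d : ℕ} {ρ : Matrix (Fin d) (Fin d) ℂ} (h : IsState ρ)
    (U : Matrix.unitaryGroup (Fin d) ℂ) : IsState (U.1 * ρ * star U.1) := by
  constructor
  · exact h.posSemidef.mul_mul_conjTranspose_same U.1
  · rw [Matrix.trace_mul_comm, ← mul_assoc, Matrix.mem_unitaryGroup_iff'.mp U.2, one_mul,
      h.trace_eq_one]

/-- The rank-`r` Haar-measure encryption of `n` messages: the key is a Haar-random unitary `U` on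
`ℂ^{rn}`, and the message `i` is encrypted as `U σᵢ U*`. -/
noncomputable def haarEncryption (r n : ℕ) (hr : 0 < r) : QECM where
  Msg := Fin n
  Key := Matrix.unitaryGroup (Fin (r * n)) ℂ
  keyDist := haarUnitary (r * n)
  Code := Fin (r * n)
  cipher U i := U.1 * blockState r n i * star U.1
  isState_cipher U i := (isState_blockState r n hr i).conj U

end Telegraph

/-!
Two encryptions `U ρ U*` and `U σ U*` can be told apart after a measurement `P` only through the
numbers `Tr[Pₓ U Δ U*]` with `Δ = ρ - σ`: for each key the bias is at most
`¼ ∑ₓ |Tr[Pₓ U Δ U*]|`. Diagonalizing `Pₓ` and using the invariance of the Haar measure, the average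
of each term is at most `Tr Pₓ` times that of `|(U Δ U*)ᵢᵢ|`, which Cauchy-Schwarz bounds by the
square root of a second moment, hence by fourth moments of a row `(u₁, …, u_d)` of `U`.
These follow from invariance alone: each `‖uⱼ + iⁿ uₖ‖⁴` averages to `4 E‖uⱼ‖⁴`, and summing over
the four phases removes the cross terms, so that `E‖uⱼ‖⁴ = 2 E‖uⱼ‖²‖uₖ‖²`; the normalization
`∑ⱼ ‖uⱼ‖² = 1` fixes the remaining constant.
-/

namespace Telegraph

open MeasureTheory Matrix

section Unitary

variable {ι : Type*} [Fintype ι] [DecidableEq ι]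

theorem exists_unitaryGroup_mulVec_single_eq {𝕜 : Type*} [RCLike 𝕜] {w : EuclideanSpace 𝕜 ι}
    (hw : ‖w‖ = 1) (j : ι) : ∃ V : unitaryGroup ι 𝕜, V.1 *ᵥ Pi.single j 1 = w.ofLp := by
  have horth : Orthonormal 𝕜 (({j} : Set ι).domRestrict fun _ => w) :=
    ⟨fun _ => hw, fun a b hab => absurd (Subsingleton.elim a b) hab⟩
  obtain ⟨b, hb⟩ := horth.exists_orthonormalBasis_extension_of_card_eq (by simp)
  refine ⟨⟨_, (EuclideanSpace.basisFun ι 𝕜).toMatrix_orthonormalBasis_mem_unitary b⟩, ?_⟩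
  ext k
  simp [Module.Basis.toMatrix_apply, hb j rfl]

theorem mul_diagonal_mul_star_apply_self (U : Matrix ι ι ℂ) (s : ι → ℝ) (i : ι) :
    (U * diagonal (fun j => (s j : ℂ)) * star U) i i = ((∑ j, s j * ‖U i j‖ ^ 2 : ℝ) : ℂ) := by
  rw [Matrix.mul_apply, Complex.ofReal_sum]
  refine Finset.sum_congr rfl fun j _ => ?_
  rw [Matrix.mul_diagonal, Matrix.star_apply, Complex.star_def, mul_right_comm, Complex.mul_conj,
    Complex.normSq_eq_norm_sq, ← Complex.ofReal_mul, mul_comm]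

theorem sum_norm_sq_unitaryGroup_row (U : unitaryGroup ι ℂ) (i : ι) : ∑ j, ‖U.1 i j‖ ^ 2 = 1 := by
  have h := mul_diagonal_mul_star_apply_self U.1 (fun _ => 1) i
  simp only [Complex.ofReal_one, diagonal_one, mul_one, mem_unitaryGroup_iff.1 U.2, one_apply_eq,
    one_mul] at h
  exact_mod_cast h.symm

theorem eq_eigenvectorUnitary_mul_diagonal_mul_star {A : Matrix ι ι ℂ} (hA : A.IsHermitian) :
    A = hA.eigenvectorUnitary.1 * diagonal (fun j => (hA.eigenvalues j : ℂ)) *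
      star hA.eigenvectorUnitary.1 :=
  hA.spectral_theorem.trans (Unitary.conjStarAlgAut_apply ..)

theorem re_trace_mul_eq_sum_eigenvalues {A : Matrix ι ι ℂ} (hA : A.IsHermitian)
    (B : Matrix ι ι ℂ) : (A * B).trace.re = ∑ j, hA.eigenvalues j *
      ((star hA.eigenvectorUnitary.1 * B * hA.eigenvectorUnitary.1) j j).re := by
  conv_lhs => rw [eq_eigenvectorUnitary_mul_diagonal_mul_star hA]
  rw [mul_assoc, trace_mul_comm, ← mul_assoc, trace_mul_comm, trace, Complex.re_sum]
  refine Finset.sum_congr rfl fun j _ => ?_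
  rw [diag_apply, diagonal_mul, Complex.re_ofReal_mul]

theorem re_trace_mul_self_eq_sum_eigenvalues_sq {A : Matrix ι ι ℂ} (hA : A.IsHermitian) :
    (A * A).trace.re = ∑ j, hA.eigenvalues j ^ 2 := by
  have hdiag : star hA.eigenvectorUnitary.1 * A * hA.eigenvectorUnitary.1 =
      diagonal (RCLike.ofReal ∘ hA.eigenvalues) :=
    (Unitary.conjStarAlgAut_star_apply ..).symm.trans hA.conjStarAlgAut_star_eigenvectorUnitary
  simp [re_trace_mul_eq_sum_eigenvalues hA A, hdiag, sq]

end Unitary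

theorem sum_norm_add_I_pow_mul_pow_four (a b : ℂ) :
    ∑ n : Fin 4, ‖a + Complex.I ^ n.1 * b‖ ^ 4 =
      4 * ‖a‖ ^ 4 + 4 * ‖b‖ ^ 4 + 16 * (‖a‖ ^ 2 * ‖b‖ ^ 2) := by
  have h (z : ℂ) : ‖z‖ ^ 4 = (z.re * z.re + z.im * z.im) ^ 2 := by
    rw [← Complex.normSq_apply, ← Complex.sq_norm]
    ring
  simp only [Fin.sum_univ_four, Fin.coe_ofNat_eq_mod, Nat.zero_mod, Nat.one_mod, Nat.reduceMod,
    pow_zero, pow_one, Complex.I_sq, Complex.I_pow_three, h, Complex.sq_norm,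
    Complex.normSq_apply, Complex.add_re, Complex.add_im, Complex.mul_re, Complex.mul_im,
    Complex.neg_re, Complex.neg_im, Complex.I_re, Complex.I_im, Complex.one_re, Complex.one_im]
  ring

theorem integral_abs_le_sqrt_integral_sq {Ω : Type*} [MeasurableSpace Ω] {μ : Measure Ω}
    [IsProbabilityMeasure μ] {f : Ω → ℝ} (hf : MemLp f 2 μ) :
    ∫ x, |f x| ∂μ ≤ √(∫ x, f x ^ 2 ∂μ) := by
  have hvar := ProbabilityTheory.variance_nonneg |f| μ
  rw [ProbabilityTheory.variance_eq_sub hf.abs, sub_nonneg] at hvar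
  simpa only [Pi.pow_apply, Pi.abs_apply, sq_abs] using Real.le_sqrt_of_sq_le hvar

theorem memLp_of_continuous_of_compactSpace {X E : Type*} [TopologicalSpace X] [CompactSpace X]
    [MeasurableSpace X] [OpensMeasurableSpace X] [NormedAddCommGroup E]
    {μ : Measure X} [IsFiniteMeasureOnCompacts μ] {f : X → E} (hf : Continuous f) (p : ENNReal) :
    MemLp f p μ :=
  hf.memLp_of_hasCompactSupport (.of_compactSpace f)

theorem integrable_of_continuous_of_compactSpace {X E : Type*} [TopologicalSpace X]
    [CompactSpace X] [MeasurableSpace X] [OpensMeasurableSpace X] [NormedAddCommGroup E]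
    {μ : Measure X} [IsFiniteMeasureOnCompacts μ] {f : X → E} (hf : Continuous f) :
    Integrable f μ :=
  hf.integrable_of_hasCompactSupport (.of_compactSpace f)

theorem isMulRightInvariant_of_isHaarMeasure_of_isProbabilityMeasure {G : Type*} [Group G]
    [TopologicalSpace G] [IsTopologicalGroup G] [LocallyCompactSpace G] [MeasurableSpace G]
    [BorelSpace G] (μ : Measure G) [μ.IsHaarMeasure] [IsProbabilityMeasure μ] :
    μ.IsMulRightInvariant where
  map_mul_right_eq_self g := by
    have : IsProbabilityMeasure (μ.map (· * g)) :=
      Measure.isProbabilityMeasure_map (by fun_prop)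
    exact Measure.isHaarMeasure_eq_of_isProbabilityMeasure _ _

section Haar

variable {d : ℕ}

instance haarUnitary_isHaarMeasure (d : ℕ) : (haarUnitary d).IsHaarMeasure :=
  inferInstanceAs (Measure.haarMeasure ⊤).IsHaarMeasure

instance haarUnitary_isMulRightInvariant (d : ℕ) : (haarUnitary d).IsMulRightInvariant :=
  isMulRightInvariant_of_isHaarMeasure_of_isProbabilityMeasure _

@[fun_prop]
theorem continuous_unitaryGroup_apply (i j : Fin d) :
    Continuous fun U : unitaryGroup (Fin d) ℂ => U.1 i j :=
  continuous_subtype_val.matrix_elem i j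

theorem integral_comp_mulVec_apply {E : Type*} [NormedAddCommGroup E] [NormedSpace ℝ E]
    (f : ℂ → E) {w : EuclideanSpace ℂ (Fin d)} (hw : ‖w‖ = 1) (i j : Fin d) :
    ∫ U, f ((U.1 *ᵥ w.ofLp) i) ∂haarUnitary d = ∫ U, f (U.1 i j) ∂haarUnitary d := by
  obtain ⟨V, hV⟩ := exists_unitaryGroup_mulVec_single_eq hw j
  rw [← integral_mul_right_eq_self (fun U : unitaryGroup (Fin d) ℂ => f (U.1 i j)) V]
  simp only [← hV, mulVec_mulVec]
  simp

theorem integral_comp_apply_eq {E : Type*} [NormedAddCommGroup E] [NormedSpace ℝ E]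
    (f : ℂ → E) (i j k : Fin d) :
    ∫ U, f (U.1 i j) ∂haarUnitary d = ∫ U, f (U.1 i k) ∂haarUnitary d := by
  simpa using integral_comp_mulVec_apply f (w := EuclideanSpace.single j 1) (by simp) i k

theorem integral_norm_mulVec_apply_pow_four (w : EuclideanSpace ℂ (Fin d)) (i j : Fin d) :
    ∫ U, ‖(U.1 *ᵥ w.ofLp) i‖ ^ 4 ∂haarUnitary d =
      ‖w‖ ^ 4 * ∫ U, ‖U.1 i j‖ ^ 4 ∂haarUnitary d := by
  rcases eq_or_ne w 0 with rfl | hw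
  · simp
  rw [← integral_comp_mulVec_apply (‖·‖ ^ 4) (norm_smul_inv_norm (𝕜 := ℂ) hw) i j,
    ← integral_const_mul]
  congr! 2
  simp [mulVec_smul, mul_pow, hw]

theorem two_mul_integral_norm_sq_mul_norm_sq (i : Fin d) {j k : Fin d} (hjk : j ≠ k) :
    2 * ∫ U, ‖U.1 i j‖ ^ 2 * ‖U.1 i k‖ ^ 2 ∂haarUnitary d =
      ∫ U, ‖U.1 i j‖ ^ 4 ∂haarUnitary d := by
  have hphase (n : Fin 4) : ∫ U, ‖U.1 i j + Complex.I ^ n.1 * U.1 i k‖ ^ 4 ∂haarUnitary d =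
      4 * ∫ U, ‖U.1 i j‖ ^ 4 ∂haarUnitary d := by
    let w : EuclideanSpace ℂ (Fin d) :=
      EuclideanSpace.single j 1 + EuclideanSpace.single k (Complex.I ^ n.1)
    have hw : ‖w‖ ^ 2 = 2 := by
      rw [sq, norm_add_sq_eq_norm_sq_add_norm_sq_of_inner_eq_zero (𝕜 := ℂ)]
      · norm_num [w]
      · simp [EuclideanSpace.inner_single_left, hjk]
    have hmoment := integral_norm_mulVec_apply_pow_four w i j
    rw [show ‖w‖ ^ 4 = (‖w‖ ^ 2) ^ 2 by ring, hw] at hmoment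
    convert! hmoment using 1
    · simp [w, mulVec_add, mul_comm]
    · norm_num
  have hsum : ∑ n : Fin 4, ∫ U, ‖U.1 i j + Complex.I ^ n.1 * U.1 i k‖ ^ 4 ∂haarUnitary d =
      4 * ∫ U, ‖U.1 i j‖ ^ 4 ∂haarUnitary d + 4 * ∫ U, ‖U.1 i k‖ ^ 4 ∂haarUnitary d +
        16 * ∫ U, ‖U.1 i j‖ ^ 2 * ‖U.1 i k‖ ^ 2 ∂haarUnitary d := by
    rw [← integral_finsetSum _ fun n _ => integrable_of_continuous_of_compactSpace (by fun_prop)]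
    simp_rw [sum_norm_add_I_pow_mul_pow_four]
    rw [integral_add, integral_add, integral_const_mul, integral_const_mul, integral_const_mul]
    all_goals exact integrable_of_continuous_of_compactSpace (by fun_prop)
  simp only [hphase, Finset.sum_const, Finset.card_univ, Fintype.card_fin, nsmul_eq_mul,
    integral_comp_apply_eq (‖·‖ ^ 4) i k j] at hsum
  push_cast at hsum
  linarith

theorem integral_norm_sq_apply (i j : Fin d) :
    ∫ U, ‖U.1 i j‖ ^ 2 ∂haarUnitary d = 1 / d := by
  have hsum : ∑ k, ∫ U, ‖U.1 i k‖ ^ 2 ∂haarUnitary d = 1 := by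
    rw [← integral_finsetSum _ fun k _ => integrable_of_continuous_of_compactSpace (by fun_prop)]
    simp [sum_norm_sq_unitaryGroup_row]
  simp only [integral_comp_apply_eq (‖·‖ ^ 2) i _ j, Finset.sum_const, Finset.card_univ,
    Fintype.card_fin, nsmul_eq_mul] at hsum
  exact eq_one_div_of_mul_eq_one_right hsum

theorem integral_norm_apply_pow_four (i j : Fin d) :
    ∫ U, ‖U.1 i j‖ ^ 4 ∂haarUnitary d = 2 / (d * (d + 1)) := by
  have hd : (0 : ℝ) < d := by exact_mod_cast i.pos
  have hrow : ∑ k, ∫ U, ‖U.1 i j‖ ^ 2 * ‖U.1 i k‖ ^ 2 ∂haarUnitary d = 1 / d := by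
    rw [← integral_finsetSum _ fun k _ => integrable_of_continuous_of_compactSpace (by fun_prop)]
    simp_rw [← Finset.mul_sum, sum_norm_sq_unitaryGroup_row, mul_one, integral_norm_sq_apply]
  have hoff : ∀ k ∈ Finset.univ.erase j, ∫ U, ‖U.1 i j‖ ^ 2 * ‖U.1 i k‖ ^ 2 ∂haarUnitary d =
      (∫ U, ‖U.1 i j‖ ^ 4 ∂haarUnitary d) / 2 := fun k hk => by
    linarith [two_mul_integral_norm_sq_mul_norm_sq i (Finset.ne_of_mem_erase hk).symm]
  rw [← Finset.add_sum_erase _ _ (Finset.mem_univ j), Finset.sum_congr rfl hoff, Finset.sum_const,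
    Finset.card_erase_of_mem (Finset.mem_univ j), Finset.card_univ, Fintype.card_fin, nsmul_eq_mul,
    Nat.cast_pred i.pos] at hrow
  simp_rw [← pow_add] at hrow
  field_simp at hrow ⊢
  linarith

theorem integral_norm_sq_mul_norm_sq_apply (i j k : Fin d) :
    ∫ U, ‖U.1 i j‖ ^ 2 * ‖U.1 i k‖ ^ 2 ∂haarUnitary d =
      (1 + if j = k then 1 else 0) / (d * (d + 1)) := by
  split_ifs with h
  · subst h
    simp_rw [← pow_add]
    rw [integral_norm_apply_pow_four, one_add_one_eq_two]
  · have hmixed := two_mul_integral_norm_sq_mul_norm_sq i h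
    rw [integral_norm_apply_pow_four] at hmixed
    linear_combination hmixed / 2

theorem integral_sq_sum_mul_norm_sq (i : Fin d) (s : Fin d → ℝ) :
    ∫ U, (∑ j, s j * ‖U.1 i j‖ ^ 2) ^ 2 ∂haarUnitary d =
      ((∑ j, s j) ^ 2 + ∑ j, s j ^ 2) / (d * (d + 1)) := by
  have hexp (U : unitaryGroup (Fin d) ℂ) : (∑ j, s j * ‖U.1 i j‖ ^ 2) ^ 2 =
      ∑ j, ∑ k, s j * s k * (‖U.1 i j‖ ^ 2 * ‖U.1 i k‖ ^ 2) := by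
    simp_rw [sq (Finset.sum ..), Finset.sum_mul_sum, mul_mul_mul_comm]
  calc ∫ U, (∑ j, s j * ‖U.1 i j‖ ^ 2) ^ 2 ∂haarUnitary d
      = ∑ j, ∑ k, s j * s k * ∫ U, ‖U.1 i j‖ ^ 2 * ‖U.1 i k‖ ^ 2 ∂haarUnitary d := by
        simp_rw [hexp]
        rw [integral_finsetSum _ fun j _ =>
          integrable_of_continuous_of_compactSpace (by fun_prop)]
        refine Finset.sum_congr rfl fun _ _ => ?_
        rw [integral_finsetSum _ fun k _ =>
          integrable_of_continuous_of_compactSpace (by fun_prop)]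
        simp_rw [integral_const_mul]
    _ = ((∑ j, s j) ^ 2 + ∑ j, s j ^ 2) / (d * (d + 1)) := by
        simp_rw [integral_norm_sq_mul_norm_sq_apply, mul_div_assoc', ← Finset.sum_div, mul_add,
          mul_one, Finset.sum_add_distrib, ← Finset.sum_mul_sum, mul_ite, mul_one, mul_zero,
          Finset.sum_ite_eq, Finset.mem_univ, if_true, sq]

theorem integral_sq_re_mul_mul_star_apply_self {A : Matrix (Fin d) (Fin d) ℂ}
    (hA : A.IsHermitian) (i : Fin d) :
    ∫ U, ((U.1 * A * star U.1) i i).re ^ 2 ∂haarUnitary d =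
      (A.trace.re ^ 2 + (A * A).trace.re) / (d * (d + 1)) := by
  have hdiag (U : unitaryGroup (Fin d) ℂ) : ((U.1 * A * star U.1) i i).re =
      ∑ j, hA.eigenvalues j * ‖(U * hA.eigenvectorUnitary).1 i j‖ ^ 2 := by
    rw [← Complex.ofReal_re (∑ j, _), ← mul_diagonal_mul_star_apply_self]
    conv_lhs => rw [eq_eigenvectorUnitary_mul_diagonal_mul_star hA]
    simp only [mul_assoc, Submonoid.coe_mul, star_mul]
  simp_rw [hdiag]
  rw [integral_mul_right_eq_self (fun U : unitaryGroup (Fin d) ℂ =>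
      (∑ j, hA.eigenvalues j * ‖U.1 i j‖ ^ 2) ^ 2) hA.eigenvectorUnitary,
    integral_sq_sum_mul_norm_sq, re_trace_mul_self_eq_sum_eigenvalues_sq hA,
    hA.trace_eq_sum_eigenvalues]
  simp

theorem integral_abs_re_mul_mul_star_apply_self_le {A : Matrix (Fin d) (Fin d) ℂ}
    (hA : A.IsHermitian) (i : Fin d) :
    ∫ U, |((U.1 * A * star U.1) i i).re| ∂haarUnitary d ≤
      √((A.trace.re ^ 2 + (A * A).trace.re) / (d * (d + 1))) := by
  rw [← integral_sq_re_mul_mul_star_apply_self hA i]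
  exact integral_abs_le_sqrt_integral_sq (memLp_of_continuous_of_compactSpace (by fun_prop) 2)

theorem integral_abs_re_trace_mul_mul_mul_star_le {P A : Matrix (Fin d) (Fin d) ℂ}
    (hP : P.PosSemidef) (hA : A.IsHermitian) :
    ∫ U, |(P * (U.1 * A * star U.1)).trace.re| ∂haarUnitary d ≤
      √((A.trace.re ^ 2 + (A * A).trace.re) / (d * (d + 1))) * P.trace.re := by
  set V := hP.1.eigenvectorUnitary
  set p := hP.1.eigenvalues
  have htrace (U : unitaryGroup (Fin d) ℂ) : (P * (U.1 * A * star U.1)).trace.re =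
      ∑ i, p i * (((V⁻¹ * U).1 * A * star (V⁻¹ * U).1) i i).re := by
    rw [re_trace_mul_eq_sum_eigenvalues hP.1]
    simp only [Submonoid.coe_mul, UnitaryGroup.inv_val, star_mul, star_star, mul_assoc, V, p]
  have hinv (i : Fin d) : ∫ U, |(((V⁻¹ * U).1 * A * star (V⁻¹ * U).1) i i).re| ∂haarUnitary d =
      ∫ U, |((U.1 * A * star U.1) i i).re| ∂haarUnitary d :=
    integral_mul_left_eq_self
      (fun U : unitaryGroup (Fin d) ℂ => |((U.1 * A * star U.1) i i).re|) V⁻¹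
  calc ∫ U, |(P * (U.1 * A * star U.1)).trace.re| ∂haarUnitary d
      ≤ ∫ U, ∑ i, p i * |(((V⁻¹ * U).1 * A * star (V⁻¹ * U).1) i i).re| ∂haarUnitary d := by
        refine integral_mono (integrable_of_continuous_of_compactSpace (by fun_prop))
          (integrable_of_continuous_of_compactSpace (by fun_prop)) fun U => ?_
        simp only [htrace]
        refine (Finset.abs_sum_le_sum_abs _ _).trans_eq (Finset.sum_congr rfl fun i _ => ?_)
        rw [abs_mul, abs_of_nonneg (hP.eigenvalues_nonneg i)]
    _ = ∑ i, p i * ∫ U, |((U.1 * A * star U.1) i i).re| ∂haarUnitary d := by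
        rw [integral_finsetSum _ fun i _ =>
          integrable_of_continuous_of_compactSpace (by fun_prop)]
        simp_rw [integral_const_mul, hinv]
    _ ≤ ∑ i, p i * √((A.trace.re ^ 2 + (A * A).trace.re) / (d * (d + 1))) :=
        Finset.sum_le_sum fun i _ => mul_le_mul_of_nonneg_left
          (integral_abs_re_mul_mul_star_apply_self_le hA i) (hP.eigenvalues_nonneg i)
    _ = √((A.trace.re ^ 2 + (A * A).trace.re) / (d * (d + 1))) * P.trace.re := by
        rw [← Finset.sum_mul, mul_comm, hP.1.trace_eq_sum_eigenvalues, Complex.re_sum]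
        simp [p]

end Haar

section Measurement

variable {X A B : Type*} [Fintype X] [Fintype A]

/-- The operation `ρ ↦ ∑ₓ Tr[Pₓ ρ] |eₓ⟩⟨eₓ|` of measuring with `P` and recording the outcome `x` as
`eₓ`. It is defined for arbitrary families; it is a measurement channel when `P` is a POVM and `e`
is orthonormal. -/
noncomputable def measureAndPrepare (P : X → Matrix A A ℂ) (e : X → EuclideanSpace ℂ B)
    (ρ : Matrix A A ℂ) : Matrix B B ℂ :=
  ∑ x, (P x * ρ).trace • vecMulVec (e x).ofLp (star (e x).ofLp)

theorem measureAndPrepare_sub (P : X → Matrix A A ℂ) (e : X → EuclideanSpace ℂ B)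
    (ρ σ : Matrix A A ℂ) :
    measureAndPrepare P e (ρ - σ) = measureAndPrepare P e ρ - measureAndPrepare P e σ := by
  simp only [measureAndPrepare, mul_sub, trace_sub, sub_smul, Finset.sum_sub_distrib]

variable [Fintype B]

theorem re_trace_mul_measureAndPrepare {Q : Matrix B B ℂ} (hQ : Q.IsHermitian)
    (P : X → Matrix A A ℂ) (e : X → EuclideanSpace ℂ B) (ρ : Matrix A A ℂ) :
    (Q * measureAndPrepare P e ρ).trace.re =
      ∑ x, (P x * ρ).trace.re * (star (e x).ofLp ⬝ᵥ Q *ᵥ (e x).ofLp).re := by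
  simp only [measureAndPrepare, Matrix.mul_sum, Matrix.mul_smul, trace_sum, trace_smul,
    Complex.re_sum, smul_eq_mul, mul_vecMulVec, trace_vecMulVec]
  refine Finset.sum_congr rfl fun x _ => ?_
  have him : (star (e x).ofLp ⬝ᵥ Q *ᵥ (e x).ofLp).im = 0 :=
    hQ.im_star_dotProduct_mulVec_self _
  rw [dotProduct_comm (Q *ᵥ _), Complex.mul_re, him, mul_zero, sub_zero]

theorem sum_re_trace_mul_eq [DecidableEq A] {P : X → Matrix A A ℂ} (hP : ∑ x, P x = 1)
    (ρ : Matrix A A ℂ) : ∑ x, (P x * ρ).trace.re = ρ.trace.re := by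
  rw [← Complex.re_sum, ← trace_sum, ← Finset.sum_mul, hP, one_mul]

theorem star_dotProduct_self_eq_one {v : EuclideanSpace ℂ B} (hv : ‖v‖ = 1) :
    star v.ofLp ⬝ᵥ v.ofLp = 1 := by
  rw [dotProduct_comm, ← EuclideanSpace.inner_eq_star_dotProduct, inner_self_eq_norm_sq_to_K, hv]
  norm_num

theorem re_trace_measureAndPrepare [DecidableEq A] {P : X → Matrix A A ℂ}
    (hP : ∑ x, P x = 1) {e : X → EuclideanSpace ℂ B} (he : ∀ x, ‖e x‖ = 1) (ρ : Matrix A A ℂ) :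
    (measureAndPrepare P e ρ).trace.re = ρ.trace.re := by
  classical
  simpa [star_dotProduct_self_eq_one (he _), sum_re_trace_mul_eq hP] using
    re_trace_mul_measureAndPrepare isHermitian_one P e ρ

theorem abs_re_star_dotProduct_mulVec_sub_half_le [DecidableEq B] {Q : Matrix B B ℂ}
    (hQ : Q.PosSemidef) (hQ' : (1 - Q).PosSemidef) {v : EuclideanSpace ℂ B} (hv : ‖v‖ = 1) :
    |(star v.ofLp ⬝ᵥ Q *ᵥ v.ofLp).re - 1 / 2| ≤ 1 / 2 := by
  have hnonneg := hQ.re_dotProduct_nonneg v.ofLp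
  have hle_one := hQ'.re_dotProduct_nonneg v.ofLp
  rw [sub_mulVec, one_mulVec, dotProduct_sub, star_dotProduct_self_eq_one hv, map_sub,
    RCLike.one_re] at hle_one
  rw [RCLike.re_to_complex] at hnonneg hle_one
  rw [abs_le]
  constructor <;> linarith

theorem abs_re_trace_mul_measureAndPrepare_le [DecidableEq A] [DecidableEq B]
    {P : X → Matrix A A ℂ} (hP : ∑ x, P x = 1) {e : X → EuclideanSpace ℂ B}
    (he : ∀ x, ‖e x‖ = 1) {Q : Matrix B B ℂ} (hQ : Q.PosSemidef) (hQ' : (1 - Q).PosSemidef)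
    {Δ : Matrix A A ℂ} (hΔ : Δ.trace.re = 0) :
    |(Q * measureAndPrepare P e Δ).trace.re| ≤ 1 / 2 * ∑ x, |(P x * Δ).trace.re| := by
  -- The numbers `Tr[Pₓ Δ]` sum to `0`, so `⟨eₓ, Q eₓ⟩ ∈ [0, 1]` may be recentred at `1 / 2`.
  have hcentre : (Q * measureAndPrepare P e Δ).trace.re =
      ∑ x, (P x * Δ).trace.re * ((star (e x).ofLp ⬝ᵥ Q *ᵥ (e x).ofLp).re - 1 / 2) := by
    simp_rw [mul_sub, Finset.sum_sub_distrib, ← Finset.sum_mul, sum_re_trace_mul_eq hP, hΔ,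
      zero_mul, sub_zero, re_trace_mul_measureAndPrepare hQ.1]
  rw [hcentre, Finset.mul_sum]
  refine (Finset.abs_sum_le_sum_abs _ _).trans (Finset.sum_le_sum fun x _ => ?_)
  rw [abs_mul, mul_comm]
  exact mul_le_mul_of_nonneg_right (abs_re_star_dotProduct_mulVec_sub_half_le hQ hQ' (he x))
    (abs_nonneg _)

theorem abs_re_trace_add_re_trace_sub_one_le [DecidableEq A] [DecidableEq B]
    {P : X → Matrix A A ℂ} (hP : ∑ x, P x = 1) {e : X → EuclideanSpace ℂ B}
    (he : ∀ x, ‖e x‖ = 1) {Q₀ Q₁ : Matrix B B ℂ} (hQ₀ : Q₀.PosSemidef) (hQ₁ : Q₁.PosSemidef)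
    (hQ : Q₀ + Q₁ = 1) {ρ₀ ρ₁ : Matrix A A ℂ} (hρ₀ : ρ₀.trace = 1) (hρ₁ : ρ₁.trace = 1) :
    |(Q₀ * measureAndPrepare P e ρ₀).trace.re + (Q₁ * measureAndPrepare P e ρ₁).trace.re - 1| ≤
      1 / 2 * ∑ x, |(P x * (ρ₀ - ρ₁)).trace.re| := by
  obtain rfl : Q₁ = 1 - Q₀ := eq_sub_of_add_eq' hQ
  have htrace : (measureAndPrepare P e ρ₁).trace.re = 1 := by
    rw [re_trace_measureAndPrepare hP he, hρ₁, Complex.one_re]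
  convert! abs_re_trace_mul_measureAndPrepare_le hP he hQ₀ hQ₁
    (show (ρ₀ - ρ₁).trace.re = 0 by simp [hρ₀, hρ₁]) using 2
  rw [measureAndPrepare_sub, sub_mul, one_mul, mul_sub, trace_sub, trace_sub, Complex.sub_re,
    Complex.sub_re, htrace]
  ring

end Measurement

section Attack

variable {Q : QECM}

/-- The success probability of an attack conditioned on the key `k`. -/
noncomputable def Attack.winProb {N : ℕ} {F : ChannelClass} (𝒜 : Attack Q N F) (k : Q.Key) : ℝ :=
  (1 / (N : ℝ)) * ∑ m : 𝒜.msgs, (𝒜.povm k m * 𝒜.channel (Q.cipher k m)).trace.re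

theorem Attack.exists_isPOVM_abs_winProb_sub_half_le (𝒜 : Attack Q 2 measurementChannels) :
    ∃ (X : Type) (_ : Fintype X) (P : X → Matrix Q.Code Q.Code ℂ) (i j : Q.Msg),
      IsPOVM P ∧ i ≠ j ∧ ∀ k, |𝒜.winProb k - 1 / 2| ≤
        1 / 4 * ∑ x, |(P x * (Q.cipher k i - Q.cipher k j)).trace.re| := by
  classical
  obtain ⟨X, hX, P, e, hP, he, hchannel⟩ := 𝒜.channel_mem
  obtain ⟨i, j, hij, huniv⟩ : ∃ i j : 𝒜.msgs, i ≠ j ∧ Finset.univ = {i, j} :=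
    Finset.card_eq_two.1 (by simpa using 𝒜.card_msgs)
  refine ⟨X, hX, P, i, j, hP, Subtype.coe_injective.ne hij, fun k => ?_⟩
  have hsum := (𝒜.isPOVM_povm k).sum_eq_one
  rw [huniv, Finset.sum_pair hij] at hsum
  have hbound := abs_re_trace_add_re_trace_sub_one_le hP.sum_eq_one he.norm_eq_one
    ((𝒜.isPOVM_povm k).posSemidef i) ((𝒜.isPOVM_povm k).posSemidef j) hsum
    (Q.isState_cipher k i).trace_eq_one (Q.isState_cipher k j).trace_eq_one
  have hwin : 𝒜.winProb k - 1 / 2 = 1 / 2 *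
      ((𝒜.povm k i * measureAndPrepare P e (Q.cipher k i)).trace.re +
        (𝒜.povm k j * measureAndPrepare P e (Q.cipher k j)).trace.re - 1) := by
    rw [Attack.winProb, huniv, Finset.sum_pair hij, hchannel, hchannel]
    simp only [measureAndPrepare]
    push_cast
    ring
  rw [hwin, abs_mul, abs_of_pos one_half_pos]
  linarith

theorem QECM.telegraphingDistinguishingValue_le {ε : ℝ}
    (hint : ∀ (P : Matrix Q.Code Q.Code ℂ) (i j : Q.Msg),
      Integrable (fun k => (P * (Q.cipher k i - Q.cipher k j)).trace.re) Q.keyDist)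
    (hε : ∀ (P : Matrix Q.Code Q.Code ℂ) (i j : Q.Msg), P.PosSemidef → i ≠ j →
      ∫ k, |(P * (Q.cipher k i - Q.cipher k j)).trace.re| ∂Q.keyDist ≤ ε * P.trace.re) :
    Q.telegraphingDistinguishingValue ≤ ((1 / 2 + ε * Fintype.card Q.Code / 4 : ℝ) : EReal) := by
  refine iSup_le fun 𝒜 => EReal.coe_le_coe_iff.2 ?_
  obtain ⟨X, _, P, i, j, hP, hij, hwin⟩ := 𝒜.exists_isPOVM_abs_winProb_sub_half_le
  have hbias : Integrable (fun k => 1 / 4 * ∑ x, |(P x * (Q.cipher k i - Q.cipher k j)).trace.re|)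
      Q.keyDist :=
    (integrable_finsetSum _ fun x _ => (hint (P x) i j).abs).const_mul _
  have hwin_int : Integrable 𝒜.winProb Q.keyDist := by
    have hsub : Integrable (fun k => 𝒜.winProb k - 1 / 2) Q.keyDist :=
      hbias.mono' (𝒜.aemeasurable_win.sub_const _).aestronglyMeasurable (.of_forall hwin)
    simpa only [sub_eq_add_neg, integrable_add_const_iff] using hsub
  calc 𝒜.prob = ∫ k, 𝒜.winProb k ∂Q.keyDist := rfl
    _ ≤ ∫ k, (1 / 2 + 1 / 4 * ∑ x, |(P x * (Q.cipher k i - Q.cipher k j)).trace.re|) ∂Q.keyDist :=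
        integral_mono hwin_int ((integrable_const _).add hbias) fun k =>
          sub_le_iff_le_add'.1 ((le_abs_self _).trans (hwin k))
    _ = 1 / 2 + 1 / 4 * ∑ x, ∫ k, |(P x * (Q.cipher k i - Q.cipher k j)).trace.re| ∂Q.keyDist := by
        rw [integral_add (integrable_const _) hbias, integral_const, probReal_univ, one_smul,
          integral_const_mul, integral_finsetSum _ fun x _ => (hint (P x) i j).abs]
    _ ≤ 1 / 2 + 1 / 4 * ∑ x, ε * (P x).trace.re := by
        gcongr with x
        exact hε _ _ _ (hP.posSemidef x) hij
    _ = 1 / 2 + ε * Fintype.card Q.Code / 4 := by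
        rw [← Finset.mul_sum, ← Complex.re_sum, ← trace_sum, hP.sum_eq_one, trace_one,
          Complex.natCast_re]
        ring

end Attack

theorem blockState_mul_self (r n : ℕ) (i : Fin n) :
    blockState r n i * blockState r n i = (1 / (r : ℂ)) • blockState r n i := by
  rw [blockState, diagonal_mul_diagonal, ← diagonal_smul]
  refine congrArg diagonal (funext fun k => ?_)
  rw [Pi.smul_apply, smul_eq_mul]
  split_ifs <;> simp

theorem blockState_mul_of_ne (r : ℕ) {n : ℕ} {i j : Fin n} (hij : i ≠ j) :
    blockState r n i * blockState r n j = 0 := by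
  rw [blockState, blockState, diagonal_mul_diagonal, ← diagonal_zero]
  refine congrArg diagonal (funext fun k => ?_)
  simp only [mul_ite, mul_zero, ite_mul, zero_mul, ← ite_and, ite_eq_right_iff, and_imp]
  intro hjk hkj hik hki
  have hij_le := Nat.lt_of_mul_lt_mul_left (hik.trans_lt hkj)
  have hji_le := Nat.lt_of_mul_lt_mul_left (hjk.trans_lt hki)
  exact absurd (Fin.ext (by omega)) hij

theorem trace_blockState_sub_mul_self {r n : ℕ} (hr : 0 < r) {i j : Fin n} (hij : i ≠ j) :
    ((blockState r n i - blockState r n j) * (blockState r n i - blockState r n j)).trace =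
      2 / r := by
  simp only [sub_mul, mul_sub, blockState_mul_self, blockState_mul_of_ne r hij,
    blockState_mul_of_ne r hij.symm, sub_zero, zero_sub, sub_neg_eq_add, trace_add, trace_smul,
    (isState_blockState r n hr _).trace_eq_one, smul_eq_mul, mul_one, ← add_div, one_add_one_eq_two]

theorem integral_abs_re_trace_mul_conj_blockState_sub_le {r n : ℕ} (hr : 0 < r)
    {P : Matrix (Fin (r * n)) (Fin (r * n)) ℂ} (hP : P.PosSemidef) {i j : Fin n} (hij : i ≠ j) :
    ∫ U, |(P * (U.1 * blockState r n i * star U.1 - U.1 * blockState r n j * star U.1)).trace.re|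
        ∂haarUnitary (r * n) ≤
      √(2 / r / ((r * n : ℕ) * ((r * n : ℕ) + 1))) * P.trace.re := by
  have hσ (m : Fin n) := isState_blockState r n hr m
  have htrace : (blockState r n i - blockState r n j).trace = 0 := by
    rw [trace_sub, (hσ i).trace_eq_one, (hσ j).trace_eq_one, sub_self]
  have hbound := integral_abs_re_trace_mul_mul_mul_star_le hP
    ((hσ i).posSemidef.isHermitian.sub (hσ j).posSemidef.isHermitian)
  rw [htrace, trace_blockState_sub_mul_self hr hij] at hbound
  simpa [mul_sub, sub_mul] using hbound

theorem telegraphingDistinguishingValue_haarEncryption_le (r n : ℕ) (hr : 0 < r) :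
    (haarEncryption r n hr).telegraphingDistinguishingValue ≤
      ((1 / 2 + √(n / (2 * (r * n + 1))) / 2 : ℝ) : EReal) := by
  have hbias : √(2 / r / ((r * n : ℕ) * ((r * n : ℕ) + 1))) * (r * n : ℕ) / 4 =
      √(n / (2 * (r * n + 1))) / 2 := by
    have hsq : (2 / r / ((r * n : ℕ) * ((r * n : ℕ) + 1)) * (r * n : ℕ) ^ 2 : ℝ) =
        2 ^ 2 * (n / (2 * (r * n + 1))) := by
      rcases n.eq_zero_or_pos with rfl | hn
      · simp
      · push_cast
        field_simp
    have hsqrt := congrArg Real.sqrt hsq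
    rw [Real.sqrt_mul' _ (sq_nonneg _), Real.sqrt_sq (Nat.cast_nonneg _),
      Real.sqrt_mul (sq_nonneg 2), Real.sqrt_sq zero_le_two] at hsqrt
    rw [hsqrt]
    ring
  have hint (P : Matrix (Fin (r * n)) (Fin (r * n)) ℂ) (i j : Fin n) : Integrable
      (fun U : unitaryGroup (Fin (r * n)) ℂ =>
        (P * (U.1 * blockState r n i * star U.1 - U.1 * blockState r n j * star U.1)).trace.re)
      (haarUnitary (r * n)) :=
    integrable_of_continuous_of_compactSpace (by fun_prop)
  have hvalue := (haarEncryption r n hr).telegraphingDistinguishingValue_le hint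
    fun P i j hP hij => integral_abs_re_trace_mul_conj_blockState_sub_le hr hP hij
  rwa [show Fintype.card (haarEncryption r n hr).Code = r * n from Fintype.card_fin _, hbias]
    at hvalue

theorem Negligible.of_abs_le {f g : ℕ → ℝ} (hf : Negligible f) (hfg : ∀ l, |g l| ≤ f l) :
    Negligible g :=
  Asymptotics.SuperpolynomialDecay.trans_abs_le hf fun l => (hfg l).trans (le_abs_self _)

theorem Negligible.sqrt {f : ℕ → ℝ} (hf : Negligible f) : Negligible fun l => √(f l) := by
  intro n
  have hlim := (hf (2 * n)).sqrt
  rw [Real.sqrt_zero] at hlim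
  refine hlim.congr fun l => ?_
  rw [Real.sqrt_mul (by positivity), mul_comm 2 n, pow_mul, Real.sqrt_sq (by positivity)]

end Telegraph

theorem mainTheorem1_general :
    (∀ (r n : ℕ) (hr : 0 < r),
      (Telegraph.haarEncryption r n hr).telegraphingDistinguishingValue ≤
        ((1 / 2 + √(n / (2 * (r * n + 1))) / 2 : ℝ) : EReal)) ∧
    (∀ (r n : ℕ → ℕ) (hr : ∀ l, 0 < r l), Telegraph.Negligible (fun l => 1 / (r l : ℝ)) →
      Telegraph.IsStronglyUntelegraphableIndistinguishable
        (fun l => Telegraph.haarEncryption (r l) (n l) (hr l))) := by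
  refine ⟨Telegraph.telegraphingDistinguishingValue_haarEncryption_le, fun r n hr hneg =>
    ⟨_, hneg.sqrt.of_abs_le fun l => ?_, fun l =>
      Telegraph.telegraphingDistinguishingValue_haarEncryption_le (r l) (n l) (hr l)⟩⟩
  rw [abs_of_nonneg (by positivity)]
  refine (half_le_self (Real.sqrt_nonneg _)).trans (Real.sqrt_le_sqrt ?_)
  have hrl : (0 : ℝ) < r l := by exact_mod_cast hr l
  rw [div_le_div_iff₀ (by positivity) hrl]
  nlinarith [mul_nonneg hrl.le (Nat.cast_nonneg (α := ℝ) (n l))]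

theorem mainTheorem1 :
    (∀ (d r : ℕ) (hr : 0 < r), d = 2 * r →
      (Telegraph.haarEncryption r 2 hr).telegraphingDistinguishingValue ≤
        ((1 / 2 + 1 / (2 * Real.sqrt ((d : ℝ) + 1)) : ℝ) : EReal)) ∧
    (∀ (d r : ℕ → ℕ) (hr : ∀ l, 0 < r l), (∀ l, d l = 2 * r l) →
      Telegraph.Negligible (fun l => 1 / (d l : ℝ)) →
        Telegraph.IsStronglyUntelegraphableIndistinguishable
          (fun l => Telegraph.haarEncryption (r l) 2 (hr l))) := by
  refine ⟨fun d r hr hd => ?_, fun d r hr hd hneg => mainTheorem1_general.2 r _ hr ?_⟩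
  · simpa [hd, mul_comm, div_mul_cancel_left₀, div_eq_mul_inv] using mainTheorem1_general.1 r 2 hr
  · simpa [Telegraph.Negligible, hd, mul_left_comm (2 : ℝ)] using hneg.const_mul 2
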